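/- **The box-basket-ball system.** Sites are indexed by $i\in\mathbb Z$. The state of a site is a triple $(a,b,c)$ of nonnegative integers with $a+c=b+1$: the site has one box and $b$ baskets, it holds $c$ balls (each in the box or in a basket), and there is room for $a$ further balls. The vacuum is $V=(1,0,0)$; put $F=(0,0,1)$. A state of the system assigns a site state $S_i$ to every $i\in\mathbb Z$, with $S_i=V$ for all but finitely many $i$. For $1\le\ell\le\infty$ the time evolution $T_\ell$ is defined by a carrier that starts at $i=-\infty$ in the state $(\ell,0,0)$ and passes all sites from left to right. When a carrier in state $(a,b,c)$ passes a site in state $(d,e,f)$, the new states are $$(d',e',f')=(d+X-Y,\;e+X-Z,\;f+Y-Z),\qquad (a',b',c')=(a-X+Y,\;b-X+Z,\;c-Y+Z),$$ $$X=\min(a+b,a+c,b+f),\quad Y=\min(e+c,d+c,d+b),\quad Z=\min(a+e,d+f,e+f)$$ (with $a=a'=\infty$ if $\ell=\infty$). **Solitons.** A finite word $A$ in site states is placed at position $x$ if its leftmost letter is at site $x$ and all sites not covered by it are $V$. It is a soliton of speed $v$ if $T_\infty$ maps the state with $A$ placed at $x$ to the state with $A$ placed at $x+v$. A soliton of speed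 $v$, written as a nonempty word that neither begins nor ends with $V$, is basic if it cannot be written as $A_1V^kA_2$ with $k\ge v$ and solitons $A_1,A_2$ that are not made of $V$'s only. A basic slow soliton is a basic soliton of speed $1$. The fast soliton $F_m$, $m>1$, is the word of $m$ letters $F$; under $T_\ell$ it moves with speed $\min(\ell,m)$, while slow solitons move with speed $1$. Let $A$ be a basic slow soliton. A ball of $A$ in the leftmost site of $A$ is called initial. If some site of $A$ other than the leftmost one contains a ball, then the highest basket of the site immediately to the left of it is called special. **Proposition.** Let $2\le\ell\le\infty$ and $m>1$, and let $A$ be a basic slow soliton with $b$ balls and $a$ baskets in total. Let $p$ be the state in which $F_m$ is placed at $x$ and $A$ is placed to the right of it, at $y$, with at least one vacuum site between them, all other sites being vacuum. Then for all sufficiently large $N$ the state $T_\ell^N(p)$ consists exactly of the following: 1. the fast soliton $F_m$, with leftmost ball at position $x+N\min(\ell,m)+(2b-a)$, that is, with phase shift $2b-a$; 2. for each non-special basket of $A$, originally at position $s$, a basket at $s+N-1$; for each special basket of $A$, originally at position $s$, a basket at $s+N$; 3. for each non-initial ball of $A$, originally at position $s$, a ball at $s+N-1$; and, if $A$ has an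 initial ball, originally at position $y$, a ball at $y+N-2$. That is, non-special baskets and non-initial slow balls are slowed by $1$, special baskets are not phase-shifted, and the initial slow ball is slowed by $2$. -/

import Mathlib

namespace BoxBasketBall

/-- The state `(a, b, c)` of a site with one box: `b` baskets, `c` balls, and room for `a` extra
balls.  Each ball occupies the box or a basket, so `c ≤ b + 1` and `a = b - c + 1`. -/
@[ext] structure Site where
  a : ℕ
  b : ℕ
  c : ℕ
  cap : a + c = b + 1

/-- The vacuum `V = (1, 0, 0)`: an empty box. -/
def V : Site := ⟨1, 0, 0, rfl⟩

/-- `F = (0, 0, 1)`: a box with a ball in it. -/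
def F : Site := ⟨0, 0, 1, rfl⟩

/-- The state `(a, b, c)` of the carrier; the first entry may be infinite. -/
@[ext] structure Carrier where
  a : ℕ∞
  b : ℕ
  c : ℕ

/-- The initial carrier `u_ℓ = (ℓ, 0, 0)`. -/
def Carrier.init (l : ℕ∞) : Carrier := ⟨l, 0, 0⟩

/-- `min (a + b, a + c, b + f)` for a carrier `(a, b, c)` and a site `(d, e, f)`. It is a natural
number also if `a` is infinite. -/
noncomputable def minX (C : Carrier) (S : Site) : ℕ :=
  (min (C.a + C.b) (min (C.a + C.c) ((C.b + S.c : ℕ) : ℕ∞))).toNat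

/-- `min (e + c, d + c, d + b)` for a carrier `(a, b, c)` and a site `(d, e, f)`. -/
def minY (C : Carrier) (S : Site) : ℕ :=
  min (S.b + C.c) (min (S.a + C.c) (S.a + C.b))

/-- `min (a + e, d + f, e + f)` for a carrier `(a, b, c)` and a site `(d, e, f)`. It is a natural
number also if `a` is infinite. -/
noncomputable def minZ (C : Carrier) (S : Site) : ℕ :=
  (min (C.a + S.b) ((min (S.a + S.c) (S.b + S.c) : ℕ) : ℕ∞)).toNat

theorem minX_top (b c : ℕ) (S : Site) : minX ⟨⊤, b, c⟩ S = b + S.c := by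
  simp only [minX, top_add, le_top, inf_of_le_right, ENat.toNat_natCast]

theorem minX_coe (a b c : ℕ) (S : Site) :
    minX ⟨a, b, c⟩ S = min (a + b) (min (a + c) (b + S.c)) := by
  have h : min ((a : ℕ∞) + b) (min ((a : ℕ∞) + c) ((b + S.c : ℕ) : ℕ∞))
      = ((min (a + b) (min (a + c) (b + S.c)) : ℕ) : ℕ∞) := by push_cast; rfl
  simp only [minX, h, ENat.toNat_natCast]

theorem minZ_top (b c : ℕ) (S : Site) :
    minZ ⟨⊤, b, c⟩ S = min (S.a + S.c) (S.b + S.c) := by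
  simp only [minZ, top_add, le_top, inf_of_le_right, ENat.toNat_natCast]

theorem minZ_coe (a b c : ℕ) (S : Site) :
    minZ ⟨a, b, c⟩ S = min (a + S.b) (min (S.a + S.c) (S.b + S.c)) := by
  have h : min ((a : ℕ∞) + S.b) ((min (S.a + S.c) (S.b + S.c) : ℕ) : ℕ∞)
      = ((min (a + S.b) (min (S.a + S.c) (S.b + S.c)) : ℕ) : ℕ∞) := rfl
  simp only [minZ, h, ENat.toNat_natCast]

/-- None of the subtractions below is truncated. -/
theorem no_truncation (C : Carrier) (S : Site) :
    minY C S ≤ S.a + minX C S ∧ minZ C S ≤ S.b + minX C S ∧ minZ C S ≤ S.c + minY C S ∧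
      (minX C S : ℕ∞) ≤ C.a + minY C S ∧ minX C S ≤ C.b + minZ C S ∧
      minY C S ≤ C.c + minZ C S := by
  obtain ⟨a, b, c⟩ := C
  cases a using ENat.recTopCoe with
  | top =>
    rw [minX_top, minZ_top]
    simp only [minY, top_add, le_top, true_and]
    omega
  | coe a =>
    rw [minX_coe, minZ_coe]
    simp only [minY]
    norm_cast
    omega

/-- The new site in the interaction `(C, S) ↦ (S', C')`, where `C = (a, b, c)`, `S = (d, e, f)`:
`d' = d + X - Y`, `e' = e + X - Z`, `f' = f + Y - Z`. -/
noncomputable def newSite (C : Carrier) (S : Site) : Site where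
  a := S.a + minX C S - minY C S
  b := S.b + minX C S - minZ C S
  c := S.c + minY C S - minZ C S
  cap := by
    have h := no_truncation C S
    have h' := S.cap
    omega

/-- The new carrier in the interaction `(C, S) ↦ (S', C')`, where `C = (a, b, c)`:
`a' = a - X + Y`, `b' = b - X + Z`, `c' = c - Y + Z`. -/
noncomputable def newCarrier (C : Carrier) (S : Site) : Carrier where
  a := C.a + minY C S - minX C S
  b := C.b + minZ C S - minX C S
  c := C.c + minZ C S - minY C S

/-- A state of the system: sites indexed by `ℤ`, all but finitely many of them vacuum. -/
@[ext] structure State where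
  site : ℤ → Site
  finite : {i | site i ≠ V}.Finite

theorem State.exists_left (p : State) : ∃ s : ℤ, ∀ i < s, p.site i = V := by
  obtain ⟨s, hs⟩ := p.finite.bddBelow
  exact ⟨s, fun i hi => by
    by_contra h
    exact absurd (hs h) (not_le.mpr hi)⟩

theorem State.exists_right (p : State) : ∃ s : ℤ, ∀ i, s < i → p.site i = V := by
  obtain ⟨s, hs⟩ := p.finite.bddAbove
  exact ⟨s, fun i hi => by
    by_contra h
    exact absurd (hs h) (not_le.mpr hi)⟩

/-- The carrier that starts as `u_ℓ` at site `s` and has passed the `n` sites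
`s, s + 1, …, s + n - 1`. -/
noncomputable def carrierFrom (l : ℕ∞) (p : State) (s : ℤ) : ℕ → Carrier
  | 0 => Carrier.init l
  | n + 1 => newCarrier (carrierFrom l p s n) (p.site (s + n))

/-- The carrier that comes from `-∞` as `u_ℓ`, just before it enters site `i`. (It does not
change on the vacuum sites to the left of everything else.) -/
noncomputable def carrierAt (l : ℕ∞) (p : State) (i : ℤ) : Carrier :=
  carrierFrom l p p.exists_left.choose (i - p.exists_left.choose).toNat

theorem newCarrier_init (l : ℕ∞) : newCarrier (Carrier.init l) V = Carrier.init l := by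
  have hX : minX (Carrier.init l) V = 0 := by simp [minX, Carrier.init, V]
  have hZ : minZ (Carrier.init l) V = 0 := by simp [minZ, Carrier.init, V]
  have hY : minY (Carrier.init l) V = 0 := by simp [minY, Carrier.init, V]
  rw [newCarrier, hX, hY, hZ]
  simp [Carrier.init]

theorem newSite_init (l : ℕ∞) : newSite (Carrier.init l) V = V := by
  have hX : minX (Carrier.init l) V = 0 := by simp [minX, Carrier.init, V]
  have hZ : minZ (Carrier.init l) V = 0 := by simp [minZ, Carrier.init, V]
  have hY : minY (Carrier.init l) V = 0 := by simp [minY, Carrier.init, V]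
  ext <;> simp only [newSite, hX, hY, hZ] <;> rfl

theorem carrierAt_left (l : ℕ∞) (p : State) :
    ∃ s : ℤ, ∀ i ≤ s, p.site (i - 1) = V ∧ carrierAt l p i = Carrier.init l := by
  refine ⟨p.exists_left.choose, fun i hi => ⟨p.exists_left.choose_spec _ (by omega), ?_⟩⟩
  rw [carrierAt, Int.toNat_of_nonpos (by omega)]
  rfl

theorem carrierAt_succ (l : ℕ∞) (p : State) (i : ℤ) :
    carrierAt l p (i + 1) = newCarrier (carrierAt l p i) (p.site i) := by
  set s := p.exists_left.choose with hs
  have hspec := p.exists_left.choose_spec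
  rw [← hs] at hspec
  rcases lt_or_ge i s with h | h
  · rw [carrierAt, carrierAt, ← hs, Int.toNat_of_nonpos (by omega),
      Int.toNat_of_nonpos (by omega), hspec i h]
    exact (newCarrier_init l).symm
  · rw [carrierAt, carrierAt, ← hs, show (i + 1 - s).toNat = (i - s).toNat + 1 by omega,
      carrierFrom, show s + ((i - s).toNat : ℤ) = i by omega]

/-- The capacity `a - b + c` of the carrier is preserved. -/
theorem newCarrier_cap (l : ℕ∞) (C : Carrier) (S : Site) (h : C.a + C.c = l + C.b) :
    (newCarrier C S).a + (newCarrier C S).c = l + (newCarrier C S).b := by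
  have ht := no_truncation C S
  obtain ⟨a, b, c⟩ := C
  simp only [newCarrier] at *
  generalize minX _ _ = X at *
  generalize minY _ _ = Y at *
  generalize minZ _ _ = Z at *
  cases a using ENat.recTopCoe with
  | top =>
    cases l using ENat.recTopCoe with
    | top => simp
    | coe l =>
      rw [top_add] at h
      exact absurd h.symm (by exact_mod_cast ENat.natCast_ne_top (l + b))
  | coe a =>
    cases l using ENat.recTopCoe with
    | top =>
      rw [top_add] at h
      exact absurd h (by exact_mod_cast ENat.natCast_ne_top (a + c))
    | coe l =>
      norm_cast at *
      omega

theorem carrierAt_cap (l : ℕ∞) (p : State) (i : ℤ) :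
    (carrierAt l p i).a + (carrierAt l p i).c = l + (carrierAt l p i).b := by
  obtain ⟨s, hs⟩ := carrierAt_left l p
  rcases le_or_gt i s with h | h
  · rw [(hs i h).2]; rfl
  · induction i, h.le using Int.leInduction with
    | base => exact absurd h (lt_irrefl _)
    | succ i hi ih =>
      rw [carrierAt_succ]
      refine newCarrier_cap l _ _ ?_
      rcases eq_or_lt_of_le hi with rfl | h'
      · rw [(hs _ le_rfl).2]; rfl
      · exact ih h'

/-- On a vacuum site the carrier drops all its baskets and, if it has any, at least one ball. -/
theorem newCarrier_vacuum (l : ℕ∞) (C : Carrier) (h : C.a + C.c = l + C.b) :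
    (newCarrier C V).b = 0 ∧ (newCarrier C V).c ≤ C.c - 1 := by
  obtain ⟨a, b, c⟩ := C
  cases a using ENat.recTopCoe with
  | top =>
    simp only [newCarrier, minX_top, minZ_top, minY, V]
    omega
  | coe a =>
    cases l using ENat.recTopCoe with
    | top =>
      rw [top_add] at h
      exact absurd h (by exact_mod_cast ENat.natCast_ne_top (a + c))
    | coe l =>
      have h' : a + c = l + b := by
        simp only at h
        exact_mod_cast h
      simp only [newCarrier, minX_coe, minZ_coe, minY, V]
      omega

theorem carrierAt_right (l : ℕ∞) (p : State) :
    ∃ s : ℤ, ∀ i, s < i → p.site i = V ∧ carrierAt l p i = Carrier.init l := by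
  obtain ⟨s, hs⟩ := p.exists_right
  have key : ∀ n : ℕ, (carrierAt l p (s + 1 + (n + 1))).b = 0 ∧
      (carrierAt l p (s + 1 + (n + 1))).c ≤ (carrierAt l p (s + 1)).c - (n + 1) := by
    intro n
    induction n with
    | zero =>
      have := newCarrier_vacuum l _ (carrierAt_cap l p (s + 1))
      rw [← hs (s + 1) (by omega), ← carrierAt_succ] at this
      simpa using this
    | succ n ih =>
      have := newCarrier_vacuum l _ (carrierAt_cap l p (s + 1 + (n + 1)))
      rw [← hs (s + 1 + (n + 1)) (by omega), ← carrierAt_succ] at this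
      push_cast
      rw [add_assoc] at this
      omega
  refine ⟨s + 1 + (carrierAt l p (s + 1)).c, fun i hi => ⟨hs i (by omega), ?_⟩⟩
  have h := key (i - s - 2).toNat
  rw [show s + 1 + (((i - s - 2).toNat : ℤ) + 1) = i by omega] at h
  have hc : (carrierAt l p i).c = 0 := by omega
  have ha := carrierAt_cap l p i
  rw [hc, h.1] at ha
  ext
  · simpa [Carrier.init] using ha
  · exact h.1
  · exact hc

/-- The time evolution `T_ℓ`, `ℓ ≤ ∞`: the carrier `u_ℓ` passes all sites from left to right. -/
noncomputable def T (l : ℕ∞) (p : State) : State where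
  site := fun i => newSite (carrierAt l p i) (p.site i)
  finite := by
    obtain ⟨s, hs⟩ := carrierAt_left l p
    obtain ⟨s', hs'⟩ := carrierAt_right l p
    refine (Set.finite_Icc (s - 1) s').subset fun i hi => ?_
    by_contra h
    refine hi ?_
    rw [Set.mem_Icc, not_and_or, not_le, not_le] at h
    rcases h with h | h
    · have h1 := (hs (i + 1) (by omega)).1
      rw [add_sub_cancel_right] at h1
      simp only [(hs i (by omega)).2, h1, newSite_init]
    · simp only [(hs' i h).2, (hs' i h).1, newSite_init]

/-- The state `⋯ V V A V V ⋯` in which the leftmost letter of the word `A` is at position `x`. -/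
def place (A : List Site) (x : ℤ) : State where
  site := fun i => if x ≤ i then A.getD (i - x).toNat V else V
  finite := by
    refine (Set.finite_Icc x (x + A.length)).subset fun i hi => ?_
    by_contra h
    refine hi ?_
    rw [Set.mem_Icc, not_and_or, not_le, not_le] at h
    by_cases hx : x ≤ i
    · simp only [if_pos hx]
      exact List.getD_eq_default _ _ (by omega)
    · simp only [if_neg hx]

/-- `A` is a soliton of speed `v`: it moves by `v` sites in every time step of `T_∞`, with no
change in internal structure. -/
def IsSoliton (A : List Site) (v : ℕ) : Prop :=
  ∀ x : ℤ, T ⊤ (place A x) = place A (x + v)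

/-- The word `A` does not consist of vacuum states only. -/
def IsNontrivial (A : List Site) : Prop := ∃ S ∈ A, S ≠ V

/-- A basic soliton of speed `v`: a soliton, written as a nonempty word without vacuum states at
its ends, that cannot be decomposed into nontrivial solitons separated by at least `v` vacuum
states. -/
structure IsBasicSoliton (A : List Site) (v : ℕ) : Prop where
  ne_nil : A ≠ []
  head_ne : A.head? ≠ some V
  last_ne : A.getLast? ≠ some V
  isSoliton : IsSoliton A v
  indecomposable : ¬ ∃ (A₁ A₂ : List Site) (k v₁ v₂ : ℕ), v ≤ k ∧
    A = A₁ ++ List.replicate k V ++ A₂ ∧ IsNontrivial A₁ ∧ IsNontrivial A₂ ∧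
    IsSoliton A₁ v₁ ∧ IsSoliton A₂ v₂

/-- A basic slow soliton is a basic soliton of speed 1. -/
def IsBasicSlow (A : List Site) : Prop := IsBasicSoliton A 1

/-- The fast soliton `F_m`: `m` consecutive balls. -/
def fast (m : ℕ) : List Site := List.replicate m F

/-- The speed `min (ℓ, m)` of `F_m` under `T_ℓ`. -/
noncomputable def fastSpeed (l : ℕ∞) (m : ℕ) : ℕ := (min l m).toNat

/-- The state `⋯ V V F_m V ⋯ V A V V ⋯`: the leftmost letter of `F_m` is at position `x`, and
there are `g` vacuum states between `F_m` and `A`, whose leftmost letter is at `x + m + g`. -/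
def twoBody (m : ℕ) (A : List Site) (x : ℤ) (g : ℕ) : State :=
  place (fast m ++ List.replicate g V ++ A) x

/-- The baskets of `A`: `⟨j, r⟩` is the `r`-th lowest basket (counted from 0) in the `j`-th site
(counted from 0). -/
def baskets (A : List Site) : Finset (Σ _ : ℕ, ℕ) :=
  (Finset.range A.length).sigma fun j => Finset.range (A.getD j V).b

/-- The balls of `A`: `⟨j, r⟩` is the `r`-th ball (counted from 0) in the `j`-th site (counted
from 0). -/
def balls (A : List Site) : Finset (Σ _ : ℕ, ℕ) :=
  (Finset.range A.length).sigma fun j => Finset.range (A.getD j V).c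

/-- A basket is special if it is the highest one of its site and there is a (necessarily
non-initial) slow ball in the next site. -/
def IsSpecial (A : List Site) (k : Σ _ : ℕ, ℕ) : Prop :=
  k.2 + 1 = (A.getD k.1 V).b ∧ 0 < (A.getD (k.1 + 1) V).c

/-- A slow ball is initial if it is in the leftmost site. -/
def IsInitial (k : Σ _ : ℕ, ℕ) : Prop := k.1 = 0

open Classical in
/-- The phase shift of a basket of `A`. -/
noncomputable def basketShift (A : List Site) (k : Σ _ : ℕ, ℕ) : ℤ :=
  if IsSpecial A k then 0 else -1

open Classical in
/-- The phase shift of a slow ball. -/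
noncomputable def ballShift (k : Σ _ : ℕ, ℕ) : ℤ :=
  if IsInitial k then -2 else -1

end BoxBasketBall

/-!
The collision is solved by an explicit formula for the state at every time, for all `ℓ` and `m`.

A word is a slow soliton exactly if every site has at most one ball and two neighbouring sites with
balls have a basket in the first of them (`isSoliton_one_iff`): when `T_∞` moves a state by one
site, conservation forces the carrier to hold the load of the site that it has just left, and the
condition says that this load is exchanged completely at the next site. Hence a basic slow soliton
has no vacuum site (it could be cut there), and each of its non-initial balls is preceded by a
special basket (`IsBasicSlow.isSlowWord_and_ne`).

Regard a slow word as a background with holes (`SlowBackground`): the boxes without a slow ball and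
the non-special baskets; for an initial ball, the box of the site before it is not a hole either.
The fast soliton always occupies `m` consecutive holes, up to slow balls that have not yet given way
to it. Once its rear end has reached a site, the slow ball of that site has moved back by one site,
into the special basket of the previous site, or by two sites if there is no such basket; and the
non-special baskets move back by one site, one by one, as the rear end passes them. So the state is
determined by the number `h` of the last hole that has been passed (`SlowBackground.IsDressed`). In the
frame that moves with the background, `T_ℓ` advances the rear end by `min ℓ m - 1` holes
(`SlowBackground.isDressed_T`). As the load of the carrier is known by conservation, this is a
statement about one site, its neighbours and the carrier (`exchange_dressed`), piecewise linear in
the data; it is proved in five cases according to where the rear end is before and after the step.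

Since `min ℓ m ≥ 2`, the rear end finally passes everything. Then each non-special basket and each
ball has moved as claimed. A slow soliton of length `L` with `a` baskets and `b` balls has
`L + a - 2 b` holes in place of the `L` holes of vacuum, which gives the phase shift `2 b - a` of
the fast soliton (`wordBackground_Q_right`).
-/

namespace BoxBasketBall

/-- The number of balls of a fast soliton of length `m` in the first `r` holes counted from its
rear end. -/
def clip (m r : ℤ) : ℤ := max 0 (min r m)

/-- The number of baskets that have left a site with `f` slow balls and `p` non-special baskets,
where `r` is the number of holes to the left of this site that the rear end of the fast soliton
has not passed yet; `r` is negative if holes of the site itself, or farther to the right, have been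
passed. Every passed hole of the site lets one of these baskets go, and if the site has a slow
ball, then one more basket leaves together with that ball. -/
def basketFlux (f p r : ℤ) : ℤ := max 0 (min (f - r) p)

/-- The number of slow balls that have left a site with `f` slow balls, for `p` and `r` as in
`basketFlux`. The ball leaves as soon as the rear end reaches the site. The summand `max 0 (-p)`
counts a ball that comes from the next site on the right and passes through, since it finds no
basket here (`p = -1`). -/
def ballFlux (f p r : ℤ) : ℤ := if r ≤ 0 then f + max 0 (-p) else 0

/-! ### The interaction of a carrier with a site of a dressed background -/

/-!
In the lemmas below, `f` is the number of balls of the site under consideration in the dressed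
state, and `(a, b, c)` is the carrier that enters it, of capacity `l`. The site has `e1` baskets and
`f1` balls in the background, its left neighbour `e0` and `f0`, and its right neighbour has `f2`
balls. The number `s` is the speed of the fast soliton relative to the background, and `r` is the
number of holes to the left of the site that the rear end has not passed yet. The numbers `t0`,
`t1`, `t2` are the values of `basketFlux` and `k0`, `k`, `ks`, `k2` those of `clip` that depend on
`r` in the case at hand.
-/

/-- The changes `X - Z` and `Y - Z` in the numbers of baskets and balls of a site
`(e + 1 - f, e, f)` when a carrier `(a, b, c)` passes it. -/
theorem exchange_eq (l a b c e f : ℤ) (hl : 1 ≤ l) (ha : 0 ≤ a) (hf : 0 ≤ f)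
    (hcap : a + c = l + b) :
    min (a + b) (min (a + c) (b + f)) - min (a + e) (min (e + 1) (e + f)) =
        b + max 0 (min (min (a - 1) (f - 1)) (l - 1)) - e ∧
      min (e + c) (min (e + 1 - f + c) (e + 1 - f + b)) - min (a + e) (min (e + 1) (e + f)) =
        min (c + min f 1) (1 + b) - min a (min f 1) - f := by
  constructor
  · omega
  · clear hl
    omega

/-- The case in which all holes up to this site have been passed. -/
theorem exchange_passed (l e0 e1 f1 f2 p a b c f : ℤ)
    (hl : 2 ≤ l) (h1 : f1 + f2 ≤ e1 + 1) (h2 : f2 ≤ p + 1) (he0 : 0 ≤ e0) (he1 : 0 ≤ e1)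
    (hf1 : 0 ≤ f1 ∧ f1 ≤ 1) (hf2 : 0 ≤ f2 ∧ f2 ≤ 1)
    (hf : f = f2 + max 0 (-p) - max 0 (f2 - e1))
    (hb : b = e0 + max 0 (e1 - f2) - max 0 (e0 - f1))
    (hc : c = f1 + max 0 (f2 - e1) - max 0 (f1 - e0)) (ha : a + c = l + b) :
    e0 + max 0 (e1 - f2) - max 0 (e0 - f1) = b + max 0 (min (min (a - 1) (f - 1)) (l - 1)) ∧
    f1 + max 0 (f2 - e1) - max 0 (f1 - e0) = min (c + min f 1) (1 + b) - min a (min f 1) := by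
  obtain rfl | rfl : f1 = 0 ∨ f1 = 1 := by omega
  all_goals obtain rfl | rfl : f2 = 0 ∨ f2 = 1 := by omega
  all_goals constructor
  all_goals omega

set_option maxHeartbeats 2000000 in
/-- The case in which the rear end of the fast soliton is in this site. -/
theorem exchange_rear_inside (l m e0 e1 f0 f1 f2 r s a b c f t1 t2 k2 : ℤ)
    (hs1 : 1 ≤ s) (hs2 : s + 1 ≤ l) (hs3 : s + 1 ≤ m) (hs4 : s + 1 = l ∨ s + 1 = m)
    (h0 : f0 + f1 ≤ e0 + 1) (h1 : f1 + f2 ≤ e1 + 1) (he0 : 0 ≤ e0) (he1 : 0 ≤ e1)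
    (hf1 : 0 ≤ f1 ∧ f1 ≤ 1) (hf2 : 0 ≤ f2 ∧ f2 ≤ 1) (ht1 : t1 = max 0 (min (f1 - r) (e1 - f2)))
    (ht2 : t2 = max 0 (min (f1 - r + s) (e1 - f2))) (hk2 : k2 = min (r + (1 + e1 - f1 - f2)) m)
    (hf : f = k2 - max 0 (f2 - e1)) (hb : b = e0 + t1 - max 0 (e0 - f1))
    (hc : c = f1 + max 0 (f2 - e1) - max 0 (f1 - e0)) (ha : a + c = l + b)
    (hr : r ≤ 0) (hr2 : 0 < r + (1 + e1 - f1 - f2)) :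
    e0 + t2 - max 0 (e0 - f1) = b + max 0 (min (min (a - 1) (f - 1)) (l - 1)) ∧
    f1 + max 0 (f2 - e1) - max 0 (f1 - e0) = min (c + min f 1) (1 + b) - min a (min f 1) := by
  obtain rfl | rfl : f1 = 0 ∨ f1 = 1 := by omega
  all_goals obtain rfl | rfl : f2 = 0 ∨ f2 = 1 := by omega
  all_goals constructor
  all_goals omega

set_option maxHeartbeats 2000000 in
/-- The case in which the rear end reaches or passes this site in the next step. -/
theorem exchange_rear_enters (l m e0 e1 f0 f1 f2 r s a b c f t2 k k2 : ℤ)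
    (hs1 : 1 ≤ s) (hs2 : s + 1 ≤ l) (hs3 : s + 1 ≤ m) (hs4 : s + 1 = l ∨ s + 1 = m)
    (h0 : f0 + f1 ≤ e0 + 1) (h1 : f1 + f2 ≤ e1 + 1) (he0 : 0 ≤ e0) (he1 : 0 ≤ e1)
    (hf1 : 0 ≤ f1 ∧ f1 ≤ 1) (hf2 : 0 ≤ f2 ∧ f2 ≤ 1) (ht2 : t2 = max 0 (min (f1 - r + s) (e1 - f2)))
    (hk : k = min r m) (hk2 : k2 = min (r + (1 + e1 - f1 - f2)) m)
    (hf : f = f1 + k2 - k) (hb : b = e0 - max 0 (e0 - f1))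
    (hc : c = k - max 0 (f1 - e0)) (ha : a + c = l + b)
    (hr : 0 < r) (hr2 : r ≤ s) :
    e0 + t2 - max 0 (e0 - f1) = b + max 0 (min (min (a - 1) (f - 1)) (l - 1)) ∧
    f1 + max 0 (f2 - e1) - max 0 (f1 - e0) = min (c + min f 1) (1 + b) - min a (min f 1) := by
  obtain rfl | rfl : f1 = 0 ∨ f1 = 1 := by omega
  all_goals obtain rfl | rfl : f2 = 0 ∨ f2 = 1 := by omega
  all_goals constructor
  all_goals omega

set_option maxHeartbeats 2000000 in
/-- The case in which the rear end reaches or passes the left neighbour, but not this site, in the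
next step. -/
theorem exchange_rear_enters_left (l m e0 e1 f0 f1 f2 r s a b c f t0 k k2 ks : ℤ)
    (hs1 : 1 ≤ s) (hs2 : s + 1 ≤ l) (hs3 : s + 1 ≤ m) (hs4 : s + 1 = l ∨ s + 1 = m)
    (h0 : f0 + f1 ≤ e0 + 1) (h1 : f1 + f2 ≤ e1 + 1) (he0 : 0 ≤ e0) (he1 : 0 ≤ e1)
    (hf0 : 0 ≤ f0 ∧ f0 ≤ 1) (hf1 : 0 ≤ f1 ∧ f1 ≤ 1) (hf2 : 0 ≤ f2 ∧ f2 ≤ 1)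
    (ht0 : t0 = max 0 (min (f0 - (r - (1 + e0 - f0 - f1)) + s) (e0 - f1))) (hk : k = min r m)
    (hk2 : k2 = min (r + (1 + e1 - f1 - f2)) m) (hks : ks = min (r - s) m)
    (hf : f = f1 + k2 - k) (hb : b = e0 - t0)
    (hc : c = k - max 0 (f1 - e0)) (ha : a + c = l + b)
    (hr : s < r) (hr2 : r - (1 + e0 - f0 - f1) ≤ s) :
    e0 - t0 = b + max 0 (min (min (a - 1) (f - 1)) (l - 1)) ∧
    ks - max 0 (f1 - e0) = min (c + min f 1) (1 + b) - min a (min f 1) := by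
  obtain rfl | rfl : f1 = 0 ∨ f1 = 1 := by omega
  all_goals obtain rfl | rfl : f2 = 0 ∨ f2 = 1 := by omega
  all_goals constructor
  all_goals omega

set_option maxHeartbeats 2000000 in
/-- The case in which the rear end reaches neither this site nor its left neighbour in the next
step. -/
theorem exchange_untouched (l m e0 e1 f0 f1 f2 r s a b c f k0 k k2 ks : ℤ)
    (hs1 : 1 ≤ s) (hs2 : s + 1 ≤ l) (hs4 : s + 1 = l ∨ s + 1 = m) (h0 : f0 + f1 ≤ e0 + 1)
    (h1 : f1 + f2 ≤ e1 + 1) (he1 : 0 ≤ e1) (hf1 : 0 ≤ f1 ∧ f1 ≤ 1) (hf2 : 0 ≤ f2 ∧ f2 ≤ 1)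
    (hk0 : k0 = min (r - (1 + e0 - f0 - f1) - s) m) (hk : k = min r m)
    (hk2 : k2 = min (r + (1 + e1 - f1 - f2)) m) (hks : ks = min (r - s) m)
    (hf : f = f1 + k2 - k) (hb : b = e0)
    (hc : c = f0 + k - k0) (ha : a + c = l + b)
    (hr : s < r - (1 + e0 - f0 - f1)) :
    e0 = b + max 0 (min (min (a - 1) (f - 1)) (l - 1)) ∧
    f0 + ks - k0 = min (c + min f 1) (1 + b) - min a (min f 1) := by
  obtain rfl | rfl : f1 = 0 ∨ f1 = 1 := by omega
  all_goals obtain rfl | rfl : f2 = 0 ∨ f2 = 1 := by omega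
  all_goals constructor
  all_goals omega

/-- The local form of the time evolution: a site of the dressed background and the carrier, which
carries what the sites to the left have lost so far, interact so that the site becomes its left
neighbour in the dressed background whose rear end has advanced by `s` holes. -/
theorem exchange_dressed (l m s e0 e1 f0 f1 f2 p r0 r r2 a b c e f : ℤ)
    (hm : 2 ≤ m) (hl : 2 ≤ l) (hs : s = min l m - 1)
    (h0 : f0 + f1 ≤ e0 + 1) (h1 : f1 + f2 ≤ e1 + 1) (h2 : f2 ≤ p + 1) (he0 : 0 ≤ e0) (he1 : 0 ≤ e1)
    (hf0 : 0 ≤ f0 ∧ f0 ≤ 1) (hf1 : 0 ≤ f1 ∧ f1 ≤ 1) (hf2 : 0 ≤ f2 ∧ f2 ≤ 1)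
    (hr0 : r0 = r - (1 + e0 - f0 - f1)) (hr2 : r2 = r + (1 + e1 - f1 - f2))
    (hf : f = f1 + ballFlux f2 p r2 - ballFlux f1 (e1 - f2) r + clip m r2 - clip m r)
    (hb : b = e0 + basketFlux f1 (e1 - f2) r - basketFlux f0 (e0 - f1) (r0 - s))
    (hc : c = f0 + ballFlux f1 (e1 - f2) r - ballFlux f0 (e0 - f1) (r0 - s) +
      clip m r - clip m (r0 - s))
    (hcap : a + c = l + b) (ha0 : 0 ≤ a) (hf' : 0 ≤ f) :
    e0 + basketFlux f1 (e1 - f2) (r - s) - basketFlux f0 (e0 - f1) (r0 - s) =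
        e + min (a + b) (min (a + c) (b + f)) - min (a + e) (min (e + 1) (e + f)) ∧
      f0 + ballFlux f1 (e1 - f2) (r - s) - ballFlux f0 (e0 - f1) (r0 - s) +
          clip m (r - s) - clip m (r0 - s) =
        f + min (e + c) (min (e + 1 - f + c) (e + 1 - f + b)) -
          min (a + e) (min (e + 1) (e + f)) := by
  obtain ⟨hX, hY⟩ := exchange_eq l a b c e f (by omega) ha0 hf' hcap
  suffices h : e0 + basketFlux f1 (e1 - f2) (r - s) - basketFlux f0 (e0 - f1) (r0 - s) =
        b + max 0 (min (min (a - 1) (f - 1)) (l - 1)) ∧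
      f0 + ballFlux f1 (e1 - f2) (r - s) - ballFlux f0 (e0 - f1) (r0 - s) +
        clip m (r - s) - clip m (r0 - s) = min (c + min f 1) (1 + b) - min a (min f 1) by
    rw [h.1, h.2]
    constructor
    · linarith
    · linarith
  clear hX hY
  obtain ⟨hs1, hs2, hs3, hs4⟩ : 1 ≤ s ∧ s + 1 ≤ l ∧ s + 1 ≤ m ∧ (s + 1 = l ∨ s + 1 = m) := by
    omega
  clear hs
  -- Values of the fluxes at a site that has been passed, or has not been reached, completely.
  have pass : ∀ f₀ e₀ f₁ t : ℤ, t + 1 + e₀ - f₀ - f₁ ≤ 0 → 0 ≤ f₁ → f₁ ≤ 1 →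
      basketFlux f₀ (e₀ - f₁) t = max 0 (e₀ - f₁) := by
    intro f₀ e₀ f₁ t _ _ _
    unfold basketFlux; omega
  have pos : ∀ f₀ p₀ t : ℤ, f₀ ≤ 1 → 0 < t → basketFlux f₀ p₀ t = 0 ∧ ballFlux f₀ p₀ t = 0 := by
    intro f₀ p₀ t _ _
    unfold basketFlux ballFlux
    rw [if_neg (by omega)]
    omega
  have neg : ∀ f₀ p₀ t : ℤ, t ≤ 0 → ballFlux f₀ p₀ t = f₀ + max 0 (-p₀) ∧ clip m t = 0 := by
    intro f₀ p₀ t _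
    unfold ballFlux clip
    rw [if_pos (by omega)]
    omega
  have clip_pos : ∀ t : ℤ, 0 ≤ t → clip m t = min t m := by
    intro t _
    unfold clip; omega
  have shift : ∀ f₀ p₀ t : ℤ, basketFlux f₀ p₀ (t - s) = max 0 (min (f₀ - t + s) p₀) := by
    intro f₀ p₀ t
    unfold basketFlux
    rw [sub_sub_eq_add_sub, add_sub_right_comm]
  have hN1 : -(e1 - f2) = f2 - e1 := neg_sub _ _
  have hN0 : -(e0 - f1) = f1 - e0 := neg_sub _ _
  rcases le_or_gt r 0 with hr | hr
  · -- The rear end has reached this site or passed it.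
    rw [pass f0 e0 f1 (r0 - s) (by omega) (by omega) (by omega)] at hb ⊢
    rw [(neg f0 _ (r0 - s) (by omega)).1, (neg 0 0 (r0 - s) (by omega)).2,
      (neg f1 _ r hr).1, (neg 0 0 r hr).2, hN1, hN0] at hc
    rw [(neg f1 _ r hr).1, (neg 0 0 r hr).2, hN1] at hf
    rw [(neg f0 _ (r0 - s) (by omega)).1, (neg 0 0 (r0 - s) (by omega)).2,
      (neg f1 _ (r - s) (by omega)).1, (neg 0 0 (r - s) (by omega)).2, hN1, hN0]
    rcases le_or_gt r2 0 with hr2' | hr2'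
    · rw [(neg f2 _ r2 hr2').1, (neg 0 0 r2 hr2').2] at hf
      rw [pass f1 e1 f2 r (by omega) (by omega) (by omega)] at hb
      rw [pass f1 e1 f2 (r - s) (by omega) (by omega) (by omega)]
      have := exchange_passed l e0 e1 f1 f2 p a b c f hl h1 h2 he0 he1 hf1 hf2
        (by linarith) hb (by linarith) hcap
      refine ⟨this.1, ?_⟩
      rw [← this.2]; ring
    · rw [(pos f2 p r2 (by omega) hr2').2, clip_pos r2 hr2'.le] at hf
      have := exchange_rear_inside l m e0 e1 f0 f1 f2 r s a b c f _ _ _ hs1 hs2 hs3 hs4 h0 h1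
        he0 he1 hf1 hf2 rfl rfl rfl (by rw [hf, hr2]; ring) hb (by linarith) hcap hr
        (by omega)
      rw [shift]
      refine ⟨this.1, ?_⟩
      rw [← this.2]; ring
  · rw [(pos f1 _ r (by omega) hr).1] at hb
    rw [(pos f1 _ r (by omega) hr).2, clip_pos r hr.le] at hc hf
    rw [(pos f2 p r2 (by omega) (by omega)).2, clip_pos r2 (by omega)] at hf
    rcases le_or_gt r s with hrs | hrs
    · rw [pass f0 e0 f1 (r0 - s) (by omega) (by omega) (by omega)] at hb ⊢
      rw [(neg f0 _ (r0 - s) (by omega)).1, (neg 0 0 (r0 - s) (by omega)).2, hN0] at hc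
      rw [(neg f0 _ (r0 - s) (by omega)).1, (neg 0 0 (r0 - s) (by omega)).2,
        (neg f1 _ (r - s) (by omega)).1, (neg 0 0 (r - s) (by omega)).2, hN1, hN0]
      have := exchange_rear_enters l m e0 e1 f0 f1 f2 r s a b c f _ _ _ hs1 hs2 hs3 hs4 h0 h1
        he0 he1 hf1 hf2 rfl rfl rfl (by rw [hf, hr2]; ring) (by linarith) (by linarith) hcap
        hr hrs
      rw [shift]
      refine ⟨this.1, ?_⟩
      rw [← this.2]; ring
    · rw [(pos f1 _ (r - s) (by omega) (by omega)).1, (pos f1 _ (r - s) (by omega) (by omega)).2,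
        clip_pos (r - s) (by omega)]
      rcases le_or_gt r0 s with hr0s | hr0s
      · rw [(neg f0 _ (r0 - s) (by omega)).1, (neg 0 0 (r0 - s) (by omega)).2, hN0] at hc ⊢
        rw [shift, hr0] at hb ⊢
        have := exchange_rear_enters_left l m e0 e1 f0 f1 f2 r s a b c f _ _ _ _ hs1 hs2 hs3 hs4
          h0 h1 he0 he1 hf0 hf1 hf2 rfl rfl rfl rfl (by rw [hf, hr2]; ring) (by linarith)
          (by linarith) hcap hrs (by omega)
        refine ⟨by rw [← this.1]; ring, ?_⟩
        rw [← this.2]; ring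
      · rw [(pos f0 _ (r0 - s) (by omega) (by omega)).1] at hb ⊢
        rw [(pos f0 _ (r0 - s) (by omega) (by omega)).2, clip_pos (r0 - s) (by omega), hr0]
          at hc ⊢
        have := exchange_untouched l m e0 e1 f0 f1 f2 r s a b c f _ _ _ _ hs1 hs2 hs4 h0 h1
          he1 hf1 hf2 rfl rfl rfl rfl (by rw [hf, hr2]; ring) (by linarith)
          (by linarith) hcap (by omega)
        refine ⟨by rw [← this.1]; ring, ?_⟩
        rw [← this.2]; ring

/-! ### Dressed backgrounds and their time evolution -/

/-- A configuration of slow solitons on `ℤ`: site `i` has `e i` baskets and `f i` balls, as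
integers to avoid truncated subtraction. The function `Q` counts the holes up to site `i`, and on
the far left a hole is numbered by its site. Site `i` has `1 + e i - f i - f (i + 1)` holes: these
are its box and its baskets, except the box if it has a ball, and except one basket (or the box, if
there is no basket) if the next site has a ball. -/
structure SlowBackground where
  e : ℤ → ℤ
  f : ℤ → ℤ
  Q : ℤ → ℤ
  e_nonneg (i : ℤ) : 0 ≤ e i
  f_mem (i : ℤ) : 0 ≤ f i ∧ f i ≤ 1
  slow (i : ℤ) : f i + f (i + 1) ≤ e i + 1
  Q_succ (i : ℤ) : Q (i + 1) = Q i + (1 + e (i + 1) - f (i + 1) - f (i + 1 + 1))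
  left : ∃ s, ∀ i ≤ s, e i = 0 ∧ f i = 0 ∧ Q i = i

namespace SlowBackground

variable (B : SlowBackground)

/-- The number of baskets that have moved from site `i` to site `i - 1` when the holes up to
number `h` have been passed by the rear end of the fast soliton. -/
def basketsMoved (h i : ℤ) : ℤ := basketFlux (B.f i) (B.e i - B.f (i + 1)) (B.Q (i - 1) - h)

/-- The number of slow balls that have moved from site `i` to site `i - 1` when the holes up
to number `h` have been passed by the rear end of the fast soliton. -/
def ballsMoved (h i : ℤ) : ℤ := ballFlux (B.f i) (B.e i - B.f (i + 1)) (B.Q (i - 1) - h)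

/-- The number of baskets at site `i` when the rear end of the fast soliton has passed the holes
up to number `h`. -/
def dressedBaskets (h i : ℤ) : ℤ := B.e i + B.basketsMoved h (i + 1) - B.basketsMoved h i

/-- The number of balls at site `i` when the `m` balls of the fast soliton are in the holes
`h + 1, …, h + m`. -/
def dressedBalls (m h i : ℤ) : ℤ :=
  B.f i + B.ballsMoved h (i + 1) - B.ballsMoved h i + clip m (B.Q i - h) - clip m (B.Q (i - 1) - h)

/-- The state `p` is the slow background, moved by `t`, with a fast soliton in the holes
`h + 1, …, h + m`. -/
def IsDressed (m h t : ℤ) (p : State) : Prop :=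
  ∀ i, ((p.site (i + t)).b : ℤ) = B.dressedBaskets h i ∧
    ((p.site (i + t)).c : ℤ) = B.dressedBalls m h i

theorem Q_mono : Monotone B.Q := by
  refine monotone_int_of_le_succ fun i => ?_
  have := B.Q_succ i
  have := B.slow (i + 1)
  omega

/-- Nothing moves at a vacuum site that is not followed by a ball. -/
theorem moved_eq_zero {h i : ℤ} (hi : B.e i = 0 ∧ B.f i = 0 ∧ B.f (i + 1) = 0) :
    B.basketsMoved h i = 0 ∧ B.ballsMoved h i = 0 := by
  simp only [basketsMoved, ballsMoved, basketFlux, ballFlux, hi]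
  constructor
  · omega
  · split <;> simp

end SlowBackground

/-- Induction from `-∞` to the right. -/
theorem forall_of_left {P : ℤ → Prop} (h₀ : ∃ s, ∀ i ≤ s, P i) (h₁ : ∀ i, P i → P (i + 1))
    (i : ℤ) : P i := by
  obtain ⟨s, hs⟩ := h₀
  have key : ∀ n : ℕ, P (s + n) := by
    intro n
    induction n with
    | zero => exact hs _ (by simp)
    | succ n ih => simpa [add_assoc] using h₁ _ ih
  rcases le_or_gt i s with hi | hi
  · exact hs i hi
  · simpa [Int.toNat_of_nonneg (sub_nonneg.2 hi.le)] using key (i - s).toNat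

theorem newSite_b_cast (C : Carrier) (S : Site) :
    ((newSite C S).b : ℤ) = S.b + minX C S - minZ C S := by
  have := no_truncation C S
  simp only [newSite]
  omega

theorem newSite_c_cast (C : Carrier) (S : Site) :
    ((newSite C S).c : ℤ) = S.c + minY C S - minZ C S := by
  have := no_truncation C S
  simp only [newSite]
  omega

theorem newCarrier_b_cast (C : Carrier) (S : Site) :
    ((newCarrier C S).b : ℤ) = C.b + S.b - (newSite C S).b := by
  have := no_truncation C S
  simp only [newSite, newCarrier]
  omega

theorem newCarrier_c_cast (C : Carrier) (S : Site) :
    ((newCarrier C S).c : ℤ) = C.c + S.c - (newSite C S).c := by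
  have := no_truncation C S
  simp only [newSite, newCarrier]
  omega

/-- A carrier of capacity `ℓ` exchanges with a site in the same way as some carrier with a finite
number of free places. If `ℓ = ∞`, then the finite capacity `l'` is taken so large that the terms
with `a` do not affect the minima and that `min l' m = m`. -/
theorem exists_finite_carrier (l : ℕ∞) (hl : 2 ≤ l) (m : ℕ) (hm : 1 < m) (C : Carrier)
    (S : Site) (h : C.a + C.c = l + C.b) :
    ∃ l' a : ℤ, 2 ≤ l' ∧ min l' m = fastSpeed l m ∧ 0 ≤ a ∧ a + C.c = l' + C.b ∧
      (minX C S : ℤ) = min (a + C.b) (min (a + C.c) (C.b + S.c)) ∧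
      (minY C S : ℤ) = min (S.b + C.c : ℤ) (min (S.b + 1 - S.c + C.c) (S.b + 1 - S.c + C.b)) ∧
      (minZ C S : ℤ) = min (a + S.b) (min (S.b + 1) (S.b + S.c)) := by
  have hcap := S.cap
  have hY : (minY C S : ℤ) =
      min (S.b + C.c : ℤ) (min (S.b + 1 - S.c + C.c) (S.b + 1 - S.c + C.b)) := by
    simp only [minY]
    omega
  obtain ⟨a, b, c⟩ := C
  cases l using ENat.recTopCoe with
  | top =>
    cases a using ENat.recTopCoe with
    | coe a =>
      rw [top_add] at h
      exact absurd h (by exact_mod_cast ENat.natCast_ne_top (a + c))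
    | top =>
      rw [minX_top, minZ_top]
      have hv : fastSpeed ⊤ m = m := by simp [fastSpeed]
      rw [hv]
      simp only
      refine ⟨m + b + 2 * c + S.c + 1, m + b + 2 * c + S.c + 1 + b - c, ?_, ?_, ?_, ?_, ?_,
        hY, ?_⟩ <;> omega
  | coe l =>
    cases a using ENat.recTopCoe with
    | top =>
      rw [top_add] at h
      exact absurd h.symm (by exact_mod_cast ENat.natCast_ne_top (l + b))
    | coe a =>
      rw [minX_coe, minZ_coe]
      have hv : fastSpeed l m = min l m := by
        have : min (l : ℕ∞) (m : ℕ∞) = ((min l m : ℕ) : ℕ∞) := by rfl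
        rw [fastSpeed, this, ENat.toNat_natCast]
      rw [hv]
      simp only at h ⊢
      norm_cast at h hl
      refine ⟨l, a, ?_, ?_, ?_, ?_, ?_, hY, ?_⟩ <;> omega

namespace SlowBackground

variable (B : SlowBackground)

/-- One time step moves the background by one site, and it moves the fast soliton by one hole less
than its speed, relative to the background. -/
theorem isDressed_T (l : ℕ∞) (hl : 2 ≤ l) (m : ℕ) (hm : 1 < m) (h t : ℤ) (p : State)
    (hp : B.IsDressed m h t p) :
    B.IsDressed m (h + fastSpeed l m - 1) (t + 1) (T l p) := by
  set h' := h + fastSpeed l m - 1 with hh'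
  -- The site `i` ends up with what the site `i - 1` of the dressed background for `h'` has.
  have key : ∀ i, ((carrierAt l p (i + 1 + t)).b : ℤ) =
        B.e i + B.basketsMoved h (i + 1) - B.basketsMoved h' i →
      ((carrierAt l p (i + 1 + t)).c : ℤ) =
        B.f i + B.ballsMoved h (i + 1) - B.ballsMoved h' i + clip m (B.Q i - h) -
          clip m (B.Q (i - 1) - h') →
      (((T l p).site (i + 1 + t)).b : ℤ) = B.dressedBaskets h' i ∧
        (((T l p).site (i + 1 + t)).c : ℤ) = B.dressedBalls m h' i := by
    intro i hb hc
    obtain ⟨he, hf⟩ := hp (i + 1)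
    obtain ⟨l', a, hl', hv, ha, hcap, hX, hY, hZ⟩ := exists_finite_carrier l hl m hm
      (carrierAt l p (i + 1 + t)) (p.site (i + 1 + t)) (carrierAt_cap l p _)
    simp only [T]
    rw [newSite_b_cast, newSite_c_cast, hX, hY, hZ]
    simp only [dressedBaskets, dressedBalls, basketsMoved, ballsMoved, add_sub_cancel_right] at *
    have hQ := B.Q_succ i
    have hQ' := B.Q_succ (i - 1)
    rw [sub_add_cancel] at hQ'
    have hQ0 : B.Q (i - 1) - h' = B.Q (i - 1) - h - (fastSpeed l m - 1) := by omega
    have hQ1 : B.Q i - h' = B.Q i - h - (fastSpeed l m - 1) := by omega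
    rw [hQ0] at hb hc
    rw [hQ0, hQ1]
    have := exchange_dressed l' m (fastSpeed l m - 1) (B.e i) (B.e (i + 1)) (B.f i) (B.f (i + 1))
      (B.f (i + 1 + 1)) (B.e (i + 1 + 1) - B.f (i + 1 + 1 + 1)) (B.Q (i - 1) - h) (B.Q i - h)
      (B.Q (i + 1) - h) a _ _ (p.site (i + 1 + t)).b _ (by omega) hl' (by rw [hv]) (B.slow i)
      (B.slow (i + 1)) (by have := B.slow (i + 1 + 1); omega) (B.e_nonneg i)
      (B.e_nonneg (i + 1)) (B.f_mem i) (B.f_mem (i + 1)) (B.f_mem (i + 1 + 1))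
      (by omega) (by omega) hf hb hc hcap ha (by omega)
    exact ⟨this.1.symm, this.2.symm⟩
  -- The carrier brings to site `i + 1 + t` what the sites on the left of it have lost.
  have step : ∀ i, ((carrierAt l p (i + 1 + t)).b : ℤ) =
        B.e i + B.basketsMoved h (i + 1) - B.basketsMoved h' i ∧
      ((carrierAt l p (i + 1 + t)).c : ℤ) =
        B.f i + B.ballsMoved h (i + 1) - B.ballsMoved h' i + clip m (B.Q i - h) -
          clip m (B.Q (i - 1) - h') := by
    obtain ⟨s₁, hs₁⟩ := carrierAt_left l p
    obtain ⟨s₂, hs₂⟩ := B.left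
    refine forall_of_left ⟨min (min (s₁ - t) s₂) (min h h') - 2, fun i hi => ?_⟩ fun i ih => ?_
    · have h0 := hs₂ i (by omega)
      have h1 := hs₂ (i + 1) (by omega)
      have h2 := hs₂ (i + 1 + 1) (by omega)
      have h3 := hs₂ (i - 1) (by omega)
      obtain ⟨hm1, hn1⟩ := B.moved_eq_zero (h := h) ⟨h1.1, h1.2.1, h2.2.1⟩
      obtain ⟨hm0, hn0⟩ := B.moved_eq_zero (h := h') ⟨h0.1, h0.2.1, h1.2.1⟩
      rw [(hs₁ (i + 1 + t) (by omega)).2, hm1, hn1, hm0, hn0, h0.1, h0.2.1, h0.2.2, h3.2.2]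
      simp only [Carrier.init, clip]
      omega
    · have hk := key i ih.1 ih.2
      have hpi := hp (i + 1)
      rw [show i + 1 + 1 + t = i + 1 + t + 1 by ring, carrierAt_succ, newCarrier_b_cast,
        newCarrier_c_cast]
      simp only [T] at hk
      rw [hk.1, hk.2, ih.1, ih.2, hpi.1, hpi.2]
      simp only [dressedBaskets, dressedBalls, add_sub_cancel_right]
      constructor <;> ring
  intro i
  rw [show i + (t + 1) = i + 1 + t by ring]
  exact key i (step i).1 (step i).2

theorem isDressed_iterate_T (l : ℕ∞) (hl : 2 ≤ l) (m : ℕ) (hm : 1 < m) (h : ℤ) (p : State)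
    (hp : B.IsDressed m h 0 p) (N : ℕ) :
    B.IsDressed m (h + N * (fastSpeed l m - 1)) N ((T l)^[N] p) := by
  induction N with
  | zero => simpa using hp
  | succ N ih =>
    rw [Function.iterate_succ_apply']
    have := B.isDressed_T l hl m hm _ _ _ ih
    push_cast
    convert this using 1
    ring

end SlowBackground

/-! ### Slow solitons -/

theorem place_site (A : List Site) (x : ℤ) (n : ℕ) : (place A x).site (x + n) = A.getD n V := by
  simp [place]

theorem place_site_left (A : List Site) {x i : ℤ} (h : i < x) : (place A x).site i = V := by
  simp only [place, if_neg (not_le.2 h)]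

/-- The infinite carrier leaves its whole load at a site, and takes all that the site has, exactly
if the site has at most one ball and the load has room for it. -/
theorem newSite_top_eq_iff (S S' : Site) :
    newSite ⟨⊤, S'.b, S'.c⟩ S = S' ↔ S.c ≤ 1 ∧ S'.c + S.c ≤ S'.b + 1 := by
  have hb := newSite_b_cast ⟨⊤, S'.b, S'.c⟩ S
  have hc := newSite_c_cast ⟨⊤, S'.b, S'.c⟩ S
  have hcap := S.cap
  have hcap' := S'.cap
  rw [minX_top, minZ_top] at hb
  rw [minZ_top] at hc
  simp only [minY] at hb hc
  constructor
  · intro h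
    rw [h] at hb hc
    omega
  · rintro ⟨h₁, h₂⟩
    have hcap'' := (newSite ⟨⊤, S'.b, S'.c⟩ S).cap
    ext <;> omega

/-- If `T_∞` moves a state by one site, then by conservation of baskets and balls the carrier holds
exactly the load of the site that it has passed last. -/
theorem T_top_eq_shift_iff (p q : State) (hpq : ∀ i, q.site (i + 1) = p.site i) :
    T ⊤ p = q ↔ ∀ i, (p.site (i + 1)).c ≤ 1 ∧
      (p.site i).c + (p.site (i + 1)).c ≤ (p.site i).b + 1 := by
  have step : ∀ i, carrierAt ⊤ p (i + 1) = ⟨⊤, (p.site i).b, (p.site i).c⟩ →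
      newSite (carrierAt ⊤ p (i + 1)) (p.site (i + 1)) = p.site i →
      carrierAt ⊤ p (i + 1 + 1) = ⟨⊤, (p.site (i + 1)).b, (p.site (i + 1)).c⟩ := by
    intro i hi hs
    have ha := carrierAt_cap ⊤ p (i + 1 + 1)
    have hb := newCarrier_b_cast (carrierAt ⊤ p (i + 1)) (p.site (i + 1))
    have hc := newCarrier_c_cast (carrierAt ⊤ p (i + 1)) (p.site (i + 1))
    rw [hs, ← carrierAt_succ, hi] at hb hc
    simp only at hb hc
    ext
    · rw [top_add, ENat.add_eq_top] at ha
      exact ha.resolve_right (ENat.natCast_ne_top _)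
    · simp only
      omega
    · simp only
      omega
  have base : ∃ s, ∀ i ≤ s, carrierAt ⊤ p (i + 1) = ⟨⊤, (p.site i).b, (p.site i).c⟩ := by
    obtain ⟨s, hs⟩ := carrierAt_left ⊤ p
    refine ⟨s - 1, fun i hi => ?_⟩
    have := hs (i + 1) (by omega)
    rw [add_sub_cancel_right] at this
    rw [this.1, this.2]
    rfl
  constructor
  · intro h
    have hs : ∀ i, newSite (carrierAt ⊤ p (i + 1)) (p.site (i + 1)) = p.site i := by
      intro i
      exact (congrArg (fun r => r.site (i + 1)) h).trans (hpq i)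
    intro i
    rw [← newSite_top_eq_iff, ← forall_of_left base (fun i hi => step i hi (hs i)) i, hs]
  · intro h
    have hs : ∀ i, carrierAt ⊤ p (i + 1) = ⟨⊤, (p.site i).b, (p.site i).c⟩ :=
      forall_of_left base fun i hi => step i hi (by
        rw [hi]
        exact (newSite_top_eq_iff _ _).2 (h i))
    refine State.ext (funext fun i => ?_)
    rw [← sub_add_cancel i 1, hpq]
    change newSite (carrierAt ⊤ p (i - 1 + 1)) (p.site (i - 1 + 1)) = _
    rw [hs]
    exact (newSite_top_eq_iff _ _).2 (h _)

/-- The words that are slow solitons: every site has at most one ball, and if two neighbouring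
sites both have a ball, then the first of them has a basket (see `isSoliton_one_iff`). -/
def IsSlowWord (A : List Site) : Prop :=
  ∀ n, (A.getD n V).c ≤ 1 ∧ (A.getD n V).c + (A.getD (n + 1) V).c ≤ (A.getD n V).b + 1

theorem isSlowWord_iff_place (A : List Site) (x : ℤ) :
    IsSlowWord A ↔ ∀ i, ((place A x).site (i + 1)).c ≤ 1 ∧
      ((place A x).site i).c + ((place A x).site (i + 1)).c ≤ ((place A x).site i).b + 1 := by
  have hV : V.b = 0 ∧ V.c = 0 := ⟨rfl, rfl⟩
  constructor
  · intro h i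
    rcases lt_or_ge i x with hi | hi
    · rw [place_site_left _ hi]
      rcases lt_or_ge (i + 1) x with hi' | hi'
      · rw [place_site_left _ hi']
        omega
      · obtain ⟨n, hn⟩ := Int.le.dest hi'
        rw [← hn, place_site]
        have := h n
        omega
    · obtain ⟨n, rfl⟩ := Int.le.dest hi
      rw [place_site, show x + (n : ℤ) + 1 = x + (n + 1 : ℕ) by push_cast; ring, place_site]
      exact ⟨(h (n + 1)).1, (h n).2⟩
  · intro h n
    have h1 := h (x + n - 1)
    have h2 := h (x + n)
    rw [sub_add_cancel, place_site] at h1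
    rw [show x + (n : ℤ) + 1 = x + (n + 1 : ℕ) by push_cast; ring, place_site, place_site] at h2
    exact ⟨h1.1, h2.2⟩

theorem isSoliton_one_iff (A : List Site) : IsSoliton A 1 ↔ IsSlowWord A := by
  have h : ∀ x, T ⊤ (place A x) = place A (x + (1 : ℕ)) ↔ IsSlowWord A := by
    intro x
    rw [isSlowWord_iff_place A x]
    refine T_top_eq_shift_iff _ _ fun i => ?_
    rcases lt_or_ge i x with hi | hi
    · rw [place_site_left _ hi, place_site_left]
      push_cast
      omega
    · obtain ⟨n, rfl⟩ := Int.le.dest hi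
      rw [place_site, show x + (n : ℤ) + 1 = x + (1 : ℕ) + n by push_cast; ring, place_site]
  exact ⟨fun hA => (h 0).1 (hA 0), fun hA x => (h x).2 hA⟩

theorem IsSlowWord.left_of_append {A₁ A₂ : List Site} (h : IsSlowWord (A₁ ++ A₂)) :
    IsSlowWord A₁ := by
  intro n
  have hV : V.b = 0 ∧ V.c = 0 := ⟨rfl, rfl⟩
  have h' := h n
  rcases lt_or_ge n A₁.length with hn | hn
  · rw [List.getD_append _ _ _ _ hn] at h'
    rcases lt_or_ge (n + 1) A₁.length with hn' | hn'
    · rwa [List.getD_append _ _ _ _ hn'] at h'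
    · rw [List.getD_eq_default _ _ hn']
      omega
  · rw [List.getD_eq_default _ _ hn, List.getD_eq_default _ _ (by omega)]
    omega

theorem IsSlowWord.right_of_append {A₁ A₂ : List Site} (h : IsSlowWord (A₁ ++ A₂)) :
    IsSlowWord A₂ := by
  intro n
  have h' := h (A₁.length + n)
  rwa [add_assoc, List.getD_append_right _ _ _ _ (by omega),
    List.getD_append_right _ _ _ _ (by omega), Nat.add_sub_cancel_left,
    Nat.add_sub_cancel_left] at h'

/-- A basic slow soliton has no vacuum site, because it could be cut there. -/
theorem IsBasicSlow.isSlowWord_and_ne {A : List Site} (hA : IsBasicSlow A) :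
    IsSlowWord A ∧ ∀ S ∈ A, S ≠ V := by
  have hs := (isSoliton_one_iff A).1 hA.isSoliton
  refine ⟨hs, ?_⟩
  rintro S hS rfl
  obtain ⟨A₁, A₂, h⟩ := List.append_of_mem hS
  refine hA.indecomposable ⟨A₁, A₂, 1, 1, 1, le_rfl, by simpa using h, ?_, ?_, ?_, ?_⟩
  · cases A₁ with
    | nil => exact absurd (by simp [h]) hA.head_ne
    | cons S A₁ => exact ⟨S, by simp, fun hV => hA.head_ne (by simp [h, hV])⟩
  · rcases List.eq_nil_or_concat A₂ with rfl | ⟨A₂, S, rfl⟩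
    · exact absurd (by simp [h]) hA.last_ne
    · exact ⟨S, by simp, fun hV => hA.last_ne (by
        rw [h, hV, List.concat_eq_append, ← List.cons_append, ← List.append_assoc,
          List.getLast?_concat])⟩
  · rw [isSoliton_one_iff]
    rw [h] at hs
    exact hs.left_of_append
  · rw [isSoliton_one_iff]
    rw [h, List.append_cons] at hs
    exact hs.right_of_append

/-! ### The initial and the final state -/

theorem place_site_right (A : List Site) {x i : ℤ} (h : x + A.length ≤ i) :
    (place A x).site i = V := by
  simp only [place, if_pos (show x ≤ i by omega)]
  exact List.getD_eq_default _ _ (by omega)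

theorem place_fast_c (m : ℕ) (x i : ℤ) :
    ((place (fast m) x).site i).c = if x ≤ i ∧ i < x + m then 1 else 0 := by
  have hV : V.c = 0 := rfl
  rcases lt_or_ge i x with h | h
  · rw [place_site_left _ h, if_neg (by omega), hV]
  · rcases lt_or_ge i (x + m) with h' | h'
    · rw [if_pos ⟨h, h'⟩]
      obtain ⟨n, rfl⟩ := Int.le.dest h
      rw [place_site, fast, List.getD_replicate _ (by omega)]
      rfl
    · rw [place_site_right _ (by simpa [fast] using h'), if_neg (by omega), hV]

theorem twoBody_site (m : ℕ) (A : List Site) (x : ℤ) (g : ℕ) (i : ℤ) :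
    ((twoBody m A x g).site i).b = ((place A (x + m + g)).site i).b ∧
      ((twoBody m A x g).site i).c =
        ((place A (x + m + g)).site i).c + if x ≤ i ∧ i < x + m then 1 else 0 := by
  have hV : V.b = 0 ∧ V.c = 0 := ⟨rfl, rfl⟩
  have hF : F.b = 0 ∧ F.c = 1 := ⟨rfl, rfl⟩
  have hlen : (fast m ++ List.replicate g V).length = m + g := by simp [fast]
  rw [twoBody]
  rcases lt_or_ge i (x + m + g) with h | h
  · rw [place_site_left A h]
    rcases lt_or_ge i x with h' | h'
    · rw [place_site_left _ h', if_neg (by omega)]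
      omega
    · obtain ⟨n, rfl⟩ := Int.le.dest h'
      rw [place_site, List.getD_append _ _ _ _ (by omega)]
      rcases lt_or_ge n m with h'' | h''
      · rw [List.getD_append _ _ _ _ (by simpa [fast] using h''), fast,
          List.getD_replicate _ h'', if_pos (by omega)]
        omega
      · rw [List.getD_append_right _ _ _ _ (by simpa [fast] using h''),
          List.getD_replicate _ (by simp [fast]; omega), if_neg (by omega)]
        omega
  · rw [if_neg (by omega)]
    obtain ⟨n, rfl⟩ := Int.le.dest h
    rw [place_site, show x + m + g + (n : ℤ) = x + (m + g + n : ℕ) by push_cast; ring, place_site,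
      List.getD_append_right _ _ _ _ (by omega), hlen, Nat.add_sub_cancel_left]
    exact ⟨rfl, rfl⟩

/-- The slow soliton `A` at position `y` as a background. -/
noncomputable def wordBackground (A : List Site) (hA : IsSlowWord A) (y : ℤ) : SlowBackground where
  e i := ((place A y).site i).b
  f i := ((place A y).site i).c
  Q i := i + ∑ j ∈ Finset.Ico (y - 1) (i + 1), (((place A y).site j).b -
    ((place A y).site j).c - ((place A y).site (j + 1)).c : ℤ)
  e_nonneg i := by positivity
  f_mem i := by
    have := ((isSlowWord_iff_place A y).1 hA (i - 1)).1
    rw [sub_add_cancel] at this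
    omega
  slow i := by
    have := ((isSlowWord_iff_place A y).1 hA i).2
    omega
  Q_succ i := by
    rcases lt_or_ge (i + 1) (y - 1) with h | h
    · have hV : V.b = 0 ∧ V.c = 0 := ⟨rfl, rfl⟩
      rw [Finset.Ico_eq_empty (by omega), Finset.Ico_eq_empty (by omega),
        place_site_left A (show i + 1 < y by omega),
        place_site_left A (show i + 1 + 1 < y by omega), hV.1, hV.2]
      simp
    · rw [← Finset.insert_Ico_right_eq_Ico_add_one h, Finset.sum_insert (by simp)]
      ring
  left := by
    refine ⟨y - 2, fun i hi => ?_⟩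
    rw [place_site_left A (show i < y by omega), Finset.Ico_eq_empty (by omega)]
    simp [V]

theorem sum_eq_sum_range (u : ℤ → ℤ) (c : ℤ) (L : ℕ) (s : Finset ℤ) (hs : ∀ n < L, c + (n : ℕ) ∈ s)
    (hu : ∀ i, (i < c ∨ c + L ≤ i) → u i = 0) :
    ∑ i ∈ s, u i = ∑ n ∈ Finset.range L, u (c + n) := by
  rw [← Finset.sum_image (s := Finset.range L) (g := fun n : ℕ => c + n) (f := u)
    (fun a _ b _ h => by simpa using h)]
  symm
  refine Finset.sum_subset (fun i hi => ?_) fun i _ hi => hu i ?_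
  · obtain ⟨n, hn, rfl⟩ := Finset.mem_image.1 hi
    exact hs n (Finset.mem_range.1 hn)
  · by_contra h
    exact hi (Finset.mem_image.2 ⟨(i - c).toNat, Finset.mem_range.2 (by omega), by omega⟩)

theorem card_baskets (A : List Site) :
    (baskets A).card = ∑ n ∈ Finset.range A.length, (A.getD n V).b := by
  simp [baskets, Finset.card_sigma]

theorem card_balls (A : List Site) :
    (balls A).card = ∑ n ∈ Finset.range A.length, (A.getD n V).c := by
  simp [balls, Finset.card_sigma]

section WordBackground

variable {A : List Site} (hA : IsSlowWord A) (y : ℤ)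

theorem wordBackground_left {i : ℤ} (hi : i < y) :
    (wordBackground A hA y).e i = 0 ∧ (wordBackground A hA y).f i = 0 := by
  simp [wordBackground, place_site_left A hi, V]

theorem wordBackground_right {i : ℤ} (hi : y + A.length ≤ i) :
    (wordBackground A hA y).e i = 0 ∧ (wordBackground A hA y).f i = 0 := by
  simp [wordBackground, place_site_right A hi, V]

theorem wordBackground_add (n : ℕ) :
    (wordBackground A hA y).e (y + n) = (A.getD n V).b ∧
      (wordBackground A hA y).f (y + n) = (A.getD n V).c := by
  simp only [wordBackground, place_site, and_self]

theorem wordBackground_Q_left {i : ℤ} (hi : i ≤ y - 2) : (wordBackground A hA y).Q i = i := by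
  simp only [wordBackground]
  rw [Finset.Ico_eq_empty (by omega)]
  simp

/-- `A` contributes one hole more than vacuum for every basket and two holes less for every ball.
This is the origin of the phase shift of the fast soliton. -/
theorem wordBackground_Q_right {i : ℤ} (hi : y + A.length ≤ i) :
    (wordBackground A hA y).Q i = i + ((baskets A).card - 2 * (balls A).card) := by
  have he : ∑ j ∈ Finset.Ico (y - 1) (i + 1), (wordBackground A hA y).e j = (baskets A).card := by
    rw [sum_eq_sum_range _ y A.length _ (fun n hn => by rw [Finset.mem_Ico]; omega), card_baskets]
    · push_cast
      exact Finset.sum_congr rfl fun n _ => (wordBackground_add hA y n).1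
    · rintro j (hj | hj)
      · exact (wordBackground_left hA y hj).1
      · exact (wordBackground_right hA y hj).1
  have hf : ∑ j ∈ Finset.Ico (y - 1) (i + 1), (wordBackground A hA y).f j = (balls A).card := by
    rw [sum_eq_sum_range _ y A.length _ (fun n hn => by rw [Finset.mem_Ico]; omega), card_balls]
    · push_cast
      exact Finset.sum_congr rfl fun n _ => (wordBackground_add hA y n).2
    · rintro j (hj | hj)
      · exact (wordBackground_left hA y hj).2
      · exact (wordBackground_right hA y hj).2
  have hf' : ∑ j ∈ Finset.Ico (y - 1) (i + 1), (wordBackground A hA y).f (j + 1) =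
      (balls A).card := by
    rw [sum_eq_sum_range _ (y - 1) A.length _ (fun n hn => by rw [Finset.mem_Ico]; omega),
      card_balls]
    · push_cast
      refine Finset.sum_congr rfl fun n _ => ?_
      rw [show y - 1 + (n : ℤ) + 1 = y + n by ring]
      exact (wordBackground_add hA y n).2
    · rintro j (hj | hj)
      · exact (wordBackground_left hA y (by omega)).2
      · exact (wordBackground_right hA y (by omega)).2
  have hQ : (wordBackground A hA y).Q i = i + ∑ j ∈ Finset.Ico (y - 1) (i + 1),
    ((wordBackground A hA y).e j - (wordBackground A hA y).f j -
      (wordBackground A hA y).f (j + 1)) := rfl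
  rw [hQ, Finset.sum_sub_distrib, Finset.sum_sub_distrib, he, hf, hf']
  ring

/-- In the initial state, the fast soliton is in the holes `x, …, x + m - 1`, and it has not passed
anything yet. -/
theorem isDressed_twoBody (m : ℕ) (hm : 1 < m) (x : ℤ) (g : ℕ) (hg : 1 ≤ g)
    (hy : y = x + m + g) :
    (wordBackground A hA y).IsDressed m (x - 1) 0 (twoBody m A x g) := by
  set B := wordBackground A hA y with hB
  have hmoved : ∀ i, B.basketsMoved (x - 1) i = 0 ∧ B.ballsMoved (x - 1) i = 0 := by
    intro i
    rcases lt_or_ge i (y - 1) with hi | hi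
    · exact B.moved_eq_zero ⟨(wordBackground_left hA y (by omega)).1,
        (wordBackground_left hA y (by omega)).2, (wordBackground_left hA y (by omega)).2⟩
    · have hQ := B.Q_mono (show y - 2 ≤ i - 1 by omega)
      rw [hB, wordBackground_Q_left hA y le_rfl, ← hB] at hQ
      have := B.f_mem i
      simp only [SlowBackground.basketsMoved, SlowBackground.ballsMoved, basketFlux, ballFlux]
      rw [if_neg (by omega)]
      omega
  intro i
  obtain ⟨hb, hc⟩ := twoBody_site m A x g i
  rw [add_zero, hb, hc, SlowBackground.dressedBaskets, SlowBackground.dressedBalls,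
    (hmoved i).1, (hmoved i).2, (hmoved (i + 1)).1, (hmoved (i + 1)).2, ← hy]
  have hf : B.f i = ((place A y).site i).c := rfl
  have he : B.e i = ((place A y).site i).b := rfl
  refine ⟨by rw [he]; ring, ?_⟩
  rw [hf]
  push_cast
  simp only [clip]
  rcases lt_or_ge i (y - 1) with hi | hi
  · rw [hB, wordBackground_Q_left hA y (by omega), wordBackground_Q_left hA y (by omega)]
    split <;> omega
  · have hQ := B.Q_mono (show y - 2 ≤ i - 1 by omega)
    have hQ' := B.Q_mono (show i - 1 ≤ i by omega)
    rw [hB, wordBackground_Q_left hA y le_rfl, ← hB] at hQ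
    rw [if_neg (by omega)]
    omega

/-- When the rear end of the fast soliton has passed everything, all non-special baskets and all
slow balls have moved. At the site to the left of `A`, the second summand of `ballsMoved` makes the
initial ball move on by one more site. -/
theorem moved_of_passed {h : ℤ} (hh : (wordBackground A hA y).Q (y + A.length) ≤ h) (i : ℤ) :
    (wordBackground A hA y).basketsMoved h i =
        max 0 ((wordBackground A hA y).e i - (wordBackground A hA y).f (i + 1)) ∧
      (wordBackground A hA y).ballsMoved h i =
        (wordBackground A hA y).f i +
          max 0 ((wordBackground A hA y).f (i + 1) - (wordBackground A hA y).e i) := by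
  set B := wordBackground A hA y with hB
  rcases lt_or_ge i (y + A.length) with hi | hi
  · have hQ := B.Q_mono hi.le
    have hQi := B.Q_succ (i - 1)
    rw [sub_add_cancel] at hQi
    have := B.f_mem (i + 1)
    have := B.slow i
    simp only [SlowBackground.basketsMoved, SlowBackground.ballsMoved, basketFlux, ballFlux]
    rw [if_pos (by omega)]
    omega
  · have h0 := wordBackground_right hA y hi
    have h1 := wordBackground_right hA y (show y + A.length ≤ i + 1 by omega)
    rw [← hB] at h0 h1
    have hz := B.moved_eq_zero (h := h) ⟨h0.1, h0.2, h1.2⟩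
    rw [hz.1, hz.2, h0.1, h0.2, h1.2]
    simp

end WordBackground

/-! ### Counting baskets and balls by their final positions -/

theorem sum_range_ite_eq_cast (L : ℕ) (u : ℕ → ℕ) (hu : ∀ n, L ≤ n → u n = 0) (z : ℤ) :
    ∑ j ∈ Finset.range L, (if (j : ℤ) = z then u j else 0) = if 0 ≤ z then u z.toNat else 0 := by
  split_ifs with hz
  · obtain ⟨n, rfl⟩ := Int.eq_ofNat_of_zero_le hz
    simp only [Nat.cast_inj, Int.toNat_natCast, Finset.sum_ite_eq', Finset.mem_range]
    split_ifs with hn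
    · rfl
    · exact (hu n (by omega)).symm
  · exact Finset.sum_eq_zero fun j _ => if_neg (by omega)

/-- If the next site has a ball, then exactly the highest basket of site `j` is special. -/
theorem sum_basketShift (A : List Site) (hA : IsSlowWord A) (j : ℕ) (z : ℤ) :
    ∑ r ∈ Finset.range (A.getD j V).b, (if (j : ℤ) + basketShift A ⟨j, r⟩ = z then 1 else 0) =
      (if (j : ℤ) = z then min (A.getD j V).b (A.getD (j + 1) V).c else 0) +
        if (j : ℤ) = z + 1 then (A.getD j V).b - (A.getD (j + 1) V).c else 0 := by
  have hc := (hA (j + 1)).1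
  rcases Nat.eq_zero_or_pos (A.getD (j + 1) V).c with h | h
  · have hs : ∀ r, basketShift A ⟨j, r⟩ = -1 := fun r => if_neg fun hs => by
      have := hs.2
      simp only at this
      omega
    simp only [hs, h, Finset.sum_const, Finset.card_range, smul_eq_mul]
    split_ifs <;> omega
  · have h1 : (A.getD (j + 1) V).c = 1 := by omega
    rcases Nat.eq_zero_or_pos (A.getD j V).b with hb | hb
    · rw [hb]
      simp
    · obtain ⟨b, hb⟩ := Nat.exists_eq_succ_of_ne_zero hb.ne'
      have hs : ∀ r ∈ Finset.range b, basketShift A ⟨j, r⟩ = -1 := fun r hr => if_neg fun hs => by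
        have := hs.1
        simp only [Finset.mem_range] at this hr
        omega
      have hs' : basketShift A ⟨j, b⟩ = 0 := if_pos ⟨hb.symm, h⟩
      rw [hb, h1, Finset.sum_range_succ, hs', Finset.sum_congr rfl fun r hr => by rw [hs r hr]]
      simp only [Finset.sum_const, Finset.card_range, smul_eq_mul]
      split_ifs <;> omega

theorem sum_ballShift (A : List Site) (j : ℕ) (z : ℤ) :
    ∑ r ∈ Finset.range (A.getD j V).c, (if (j : ℤ) + ballShift ⟨j, r⟩ = z then 1 else 0) =
      (if (j : ℤ) = z + 1 then (if j = 0 then 0 else (A.getD j V).c) else 0) +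
        if (j : ℤ) = z + 2 then (if j = 0 then (A.getD j V).c else 0) else 0 := by
  rcases Nat.eq_zero_or_pos j with rfl | hj
  · have hs : ∀ r, ballShift ⟨0, r⟩ = -2 := fun r => if_pos rfl
    simp only [hs, Finset.sum_const, Finset.card_range, smul_eq_mul]
    split_ifs <;> omega
  · have hs : ∀ r, ballShift ⟨j, r⟩ = -1 := fun r => if_neg hj.ne'
    simp only [hs, Finset.sum_const, Finset.card_range, smul_eq_mul]
    split_ifs <;> omega

theorem card_filter_sigma (L : ℕ) (b : ℕ → ℕ) (φ : (Σ _ : ℕ, ℕ) → ℤ) (z : ℤ) :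
    {k ∈ (Finset.range L).sigma fun j => Finset.range (b j) | k.1 + φ k = z}.card =
      ∑ j ∈ Finset.range L, ∑ r ∈ Finset.range (b j), if (j : ℤ) + φ ⟨j, r⟩ = z then 1 else 0 := by
  rw [Finset.card_filter, Finset.sum_sigma]

variable {A : List Site} (hA : IsSlowWord A) (y : ℤ)

/-- The number of baskets of `A` that end up at site `y + z`, in the frame moving with `A`. -/
theorem card_baskets_shift (z : ℤ) :
    (({k ∈ baskets A | k.1 + basketShift A k = z}.card : ℕ) : ℤ) =
      (wordBackground A hA y).e (y + z) +
        max 0 ((wordBackground A hA y).e (y + z + 1) - (wordBackground A hA y).f (y + z + 1 + 1)) -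
        max 0 ((wordBackground A hA y).e (y + z) - (wordBackground A hA y).f (y + z + 1)) := by
  have hV : V.b = 0 ∧ V.c = 0 := ⟨rfl, rfl⟩
  have h0 : ∀ n, A.length ≤ n → (A.getD n V).b = 0 := fun n hn => by
    rw [List.getD_eq_default _ _ hn, hV.1]
  rw [baskets, card_filter_sigma, Finset.sum_congr rfl fun j _ => sum_basketShift A hA j z,
    Finset.sum_add_distrib,
    sum_range_ite_eq_cast _ (fun j => min (A.getD j V).b (A.getD (j + 1) V).c)
      (fun n hn => by have := h0 n hn; omega),
    sum_range_ite_eq_cast _ (fun j => (A.getD j V).b - (A.getD (j + 1) V).c)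
      (fun n hn => by have := h0 n hn; omega)]
  rcases lt_or_ge z (-1) with hz | hz
  · rw [if_neg (by omega), if_neg (by omega), (wordBackground_left hA y (by omega)).1,
      (wordBackground_left hA y (by omega)).1,
      (wordBackground_left hA y (show y + z + 1 < y by omega)).2]
    have := (wordBackground A hA y).f_mem (y + z + 1 + 1)
    omega
  obtain ⟨n, hn⟩ := Int.le.dest hz
  have e1 := wordBackground_add hA y n
  have e2 := (wordBackground_add hA y (n + 1)).2
  rw [show y + (n : ℤ) = y + z + 1 by omega] at e1
  rw [show y + ((n + 1 : ℕ) : ℤ) = y + z + 1 + 1 by omega] at e2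
  rw [e1.1, e1.2, e2, if_pos (show 0 ≤ z + 1 by omega), show (z + 1).toNat = n by omega]
  cases n with
  | zero =>
    rw [if_neg (by omega), (wordBackground_left hA y (by omega)).1]
    omega
  | succ n =>
    have e0 := (wordBackground_add hA y n).1
    rw [show y + (n : ℤ) = y + z by omega] at e0
    rw [e0, if_pos (by omega), show z.toNat = n by omega]
    omega

/-- The number of slow balls of `A` that end up at site `y + z`, in the frame moving with `A`. -/
theorem card_balls_shift (hne : ∀ S ∈ A, S ≠ V) (z : ℤ) :
    (({k ∈ balls A | k.1 + ballShift k = z}.card : ℕ) : ℤ) =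
      (wordBackground A hA y).f (y + z + 1) +
        max 0 ((wordBackground A hA y).f (y + z + 1 + 1) - (wordBackground A hA y).e (y + z + 1)) -
        max 0 ((wordBackground A hA y).f (y + z + 1) - (wordBackground A hA y).e (y + z)) := by
  have hV : V.b = 0 ∧ V.c = 0 := ⟨rfl, rfl⟩
  have h0 : ∀ n, A.length ≤ n → (A.getD n V).c = 0 := fun n hn => by
    rw [List.getD_eq_default _ _ hn, hV.2]
  -- Inside `A`, a ball is preceded by a site with a basket, as this site is not vacuum.
  have hbasket : ∀ n, (A.getD (n + 1) V).c ≤ (A.getD n V).b := by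
    intro n
    rcases lt_or_ge n A.length with hn | hn
    · have h1 := hA n
      have h2 := (hA (n + 1)).1
      have h3 := (A.getD n V).cap
      have h4 : A.getD n V ≠ V := by
        rw [List.getD_eq_getElem _ _ hn]
        exact hne _ (List.getElem_mem hn)
      by_contra h5
      refine h4 (Site.ext ?_ ?_ ?_)
      · have : V.a = 1 := rfl
        omega
      · omega
      · omega
    · rw [h0 (n + 1) (by omega)]
      exact Nat.zero_le _
  rw [balls, card_filter_sigma, Finset.sum_congr rfl fun j _ => sum_ballShift A j z,
    Finset.sum_add_distrib,
    sum_range_ite_eq_cast _ (fun j => if j = 0 then 0 else (A.getD j V).c)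
      (fun n hn => by have := h0 n hn; split <;> omega),
    sum_range_ite_eq_cast _ (fun j => if j = 0 then (A.getD j V).c else 0)
      (fun n hn => by have := h0 n hn; split <;> omega)]
  rcases lt_or_ge z (-2) with hz | hz
  · rw [if_neg (by omega), if_neg (by omega), (wordBackground_left hA y (by omega)).2,
      (wordBackground_left hA y (by omega)).2, (wordBackground_left hA y (by omega)).1,
      (wordBackground_left hA y (by omega)).1]
    rfl
  obtain ⟨n, hn⟩ := Int.le.dest hz
  have e1 := (wordBackground_add hA y n).2
  rw [show y + (n : ℤ) = y + z + 1 + 1 by omega] at e1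
  rw [e1, if_pos (show 0 ≤ z + 2 by omega), show (z + 2).toNat = n by omega]
  match n, hn with
  | 0, hn =>
    rw [if_neg (by omega), if_pos rfl, (wordBackground_left hA y (by omega)).1,
      (wordBackground_left hA y (by omega)).1, (wordBackground_left hA y (by omega)).2]
    omega
  | 1, hn =>
    have e0 := wordBackground_add hA y 0
    rw [show y + ((0 : ℕ) : ℤ) = y + z + 1 by omega] at e0
    have := hbasket 0
    rw [zero_add] at this
    rw [e0.1, e0.2, if_pos (show 0 ≤ z + 1 by omega), if_pos (show (z + 1).toNat = 0 by omega),
      if_neg one_ne_zero,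
      (wordBackground_left hA y (by omega)).1]
    omega
  | n + 2, hn =>
    have e0 := wordBackground_add hA y (n + 1)
    have e' := (wordBackground_add hA y n).1
    rw [show y + ((n + 1 : ℕ) : ℤ) = y + z + 1 by omega] at e0
    rw [show y + (n : ℤ) = y + z by omega] at e'
    have h1 := hbasket n
    have h2 : (A.getD (n + 2) V).c ≤ (A.getD (n + 1) V).b := hbasket (n + 1)
    rw [e0.1, e0.2, e', if_pos (show 0 ≤ z + 1 by omega), show (z + 1).toNat = n + 1 by omega,
      if_neg (Nat.succ_ne_zero n), if_neg (Nat.succ_ne_zero (n + 1))]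
    omega

end BoxBasketBall

theorem mainTheorem3 (l : ℕ∞) (hl : 2 ≤ l) (m : ℕ) (hm : 1 < m)
    (A : List BoxBasketBall.Site) (hA : BoxBasketBall.IsBasicSlow A)
    (x : ℤ) (g : ℕ) (hg : 1 ≤ g) :
    ∃ N₀ : ℕ, ∀ N : ℕ, N₀ ≤ N → ∀ i : ℤ,
      (((BoxBasketBall.T l)^[N] (BoxBasketBall.twoBody m A x g)).site i).b =
          {k ∈ BoxBasketBall.baskets A |
            (x + m + g) + k.1 + N + BoxBasketBall.basketShift A k = i}.card ∧
      (((BoxBasketBall.T l)^[N] (BoxBasketBall.twoBody m A x g)).site i).c =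
          {k ∈ BoxBasketBall.balls A |
            (x + m + g) + k.1 + N + BoxBasketBall.ballShift k = i}.card +
          ((BoxBasketBall.place (BoxBasketBall.fast m)
            (x + N * BoxBasketBall.fastSpeed l m +
              (2 * (BoxBasketBall.balls A).card - (BoxBasketBall.baskets A).card))).site i).c := by
  open BoxBasketBall in
  obtain ⟨hslow, hne⟩ := hA.isSlowWord_and_ne
  set y : ℤ := x + m + g with hy
  set B := wordBackground A hslow y with hB
  have hv : 2 ≤ fastSpeed l m := by
    obtain ⟨l', a, hl', hv, -⟩ := exists_finite_carrier l hl m hm (Carrier.init l) V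
      (by simp [Carrier.init])
    omega
  -- The rear end starts behind hole `x` and advances by at least one hole in every time step.
  refine ⟨(B.Q (y + A.length) - (x - 1)).toNat, fun N hN i => ?_⟩
  have hdressed := B.isDressed_iterate_T l hl m hm (x - 1) _
    (isDressed_twoBody hslow y m hm x g hg hy) N (i - N)
  set h : ℤ := x - 1 + N * (fastSpeed l m - 1) with hh
  have hQh : B.Q (y + A.length) ≤ h := by
    have : (N : ℤ) * 1 ≤ N * (fastSpeed l m - 1) :=
      mul_le_mul_of_nonneg_left (by omega) (by positivity)
    omega
  rw [sub_add_cancel, SlowBackground.dressedBaskets, SlowBackground.dressedBalls,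
    (moved_of_passed hslow y hQh _).1, (moved_of_passed hslow y hQh _).2,
    (moved_of_passed hslow y hQh _).1, (moved_of_passed hslow y hQh _).2] at hdressed
  obtain ⟨hb, hc⟩ := hdressed
  have hfb : ∀ k : Σ _ : ℕ, ℕ, y + k.1 + N + basketShift A k = i ↔
      k.1 + basketShift A k = i - N - y := fun k => by omega
  have hfc : ∀ k : Σ _ : ℕ, ℕ, y + k.1 + N + ballShift k = i ↔
      k.1 + ballShift k = i - N - y := fun k => by omega
  have h1 := card_baskets_shift hslow y (i - N - y)
  have h2 := card_balls_shift hslow y hne (i - N - y)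
  rw [add_sub_cancel, ← hB] at h1 h2
  rw [← hB] at hb hc
  simp only [hfb, hfc]
  refine ⟨by omega, ?_⟩
  rw [place_fast_c]
  have hz : x + N * fastSpeed l m + (2 * ((balls A).card : ℤ) - (baskets A).card) =
      h + N + 1 - ((baskets A).card - 2 * (balls A).card) := by
    rw [hh]; ring
  rw [hz]
  -- To the right of `A`, hole `h + k` is in the site `h + k - (#baskets - 2 * #balls)`.
  have hclip : clip m (B.Q (i - N) - h) - clip m (B.Q (i - N - 1) - h) =
      ((if h + N + 1 - ((baskets A).card - 2 * (balls A).card) ≤ i ∧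
        i < h + N + 1 - ((baskets A).card - 2 * (balls A).card) + m then 1 else 0 : ℕ) : ℤ) := by
    have hR := wordBackground_Q_right hslow y (le_refl (y + A.length))
    rw [← hB] at hR
    simp only [clip]
    rcases le_or_gt (i - N) (y + A.length) with hi | hi
    · have hQ := B.Q_mono hi
      have hQ' := B.Q_mono (show i - N - 1 ≤ i - N by omega)
      rw [if_neg (by omega)]
      omega
    · rw [hB, wordBackground_Q_right hslow y hi.le, wordBackground_Q_right hslow y (by omega)]
      split <;> omega
  omega
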